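/- For an integer $m\ge 2$, let $G(m)$ be the subdivided star with $m$ branches, that is, the unweighted graph obtained from the star $K_{1,m}$ by subdividing each edge exactly once: it has a vertex of degree $m$ adjacent to $m$ vertices of degree two, each of which is adjacent to its own leaf. Let $A$ be the adjacency matrix of $G(m)$ and let $U(t)=e^{itA}$ for $t\in\mathbb{R}$. A vertex $u$ is sedentary if $\inf_{t>0}|U(t)_{u,u}|>0$, and not sedentary if $\inf_{t>0}|U(t)_{u,u}|=0$. Then for every $m\ge 2$, no vertex of $G(m)$ is sedentary; that is, $\inf_{t>0}|U(t)_{u,u}|=0$ for every vertex $u$ of $G(m)$. -/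

import Mathlib

namespace QuantumWalk

/-- The transition matrix `U(t) = exp (i t A)` of the continuous-time quantum walk on an
unweighted graph `X` with adjacency matrix `A`. -/
noncomputable def transitionMatrix {V : Type*} [Fintype V] [DecidableEq V]
    (X : SimpleGraph V) [DecidableRel X.Adj] (t : ℝ) : Matrix V V ℂ :=
  NormedSpace.exp ((Complex.I * (t : ℂ)) • X.adjMatrix ℂ)

/-- The infimum of `|U(t)_{u,u}|` over all `t > 0`. The family is nonempty and bounded below
by zero, so this is a genuine infimum. -/
noncomputable def returnInf {V : Type*} [Fintype V] [DecidableEq V]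
    (X : SimpleGraph V) [DecidableRel X.Adj] (u : V) : ℝ :=
  ⨅ t : Set.Ioi (0 : ℝ), ‖transitionMatrix X (t : ℝ) u u‖

/-- The vertex `u` is not sedentary in `X`: the infimum of `|U(t)_{u,u}|` over `t > 0` is zero. -/
def VertexNotSedentary {V : Type*} [Fintype V] [DecidableEq V]
    (X : SimpleGraph V) [DecidableRel X.Adj] (u : V) : Prop :=
  returnInf X u = 0

/-- The graph `X` is not sedentary: none of its vertices is sedentary. -/
def NotSedentary {V : Type*} [Fintype V] [DecidableEq V]
    (X : SimpleGraph V) [DecidableRel X.Adj] : Prop :=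
  ∀ u : V, VertexNotSedentary X u

/-- The vertices of the subdivided star with `m` branches: a centre, and on each branch `j`
a middle vertex and a leaf. -/
inductive StarVertex (m : ℕ) : Type
  | center : StarVertex m
  | mid (j : Fin m) : StarVertex m
  | leaf (j : Fin m) : StarVertex m
  deriving DecidableEq, Fintype

/-- The subdivided star `G(m)`: the star `K_{1,m}` with each edge subdivided once. The centre is
adjacent to every middle vertex, and each middle vertex to the leaf of its own branch. -/
def subdividedStar (m : ℕ) : SimpleGraph (StarVertex m) where
  Adj
    | .center, .mid _ => True
    | .mid _, .center => True
    | .mid i, .leaf j => i = j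
    | .leaf i, .mid j => i = j
    | _, _ => False
  symm := ⟨by rintro (_ | i | i) (_ | j | j) h <;> first | exact h | exact Eq.symm h⟩
  loopless := ⟨by rintro (_ | i | i) h <;> exact h⟩

instance (m : ℕ) : DecidableRel (subdividedStar m).Adj
  | .center, .center => inferInstanceAs (Decidable False)
  | .center, .mid _ => inferInstanceAs (Decidable True)
  | .center, .leaf _ => inferInstanceAs (Decidable False)
  | .mid _, .center => inferInstanceAs (Decidable True)
  | .mid _, .mid _ => inferInstanceAs (Decidable False)
  | .mid i, .leaf j => inferInstanceAs (Decidable (i = j))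
  | .leaf _, .center => inferInstanceAs (Decidable False)
  | .leaf i, .mid j => inferInstanceAs (Decidable (i = j))
  | .leaf _, .leaf _ => inferInstanceAs (Decidable False)

end QuantumWalk

/-!
Every diagonal entry of `U(t)` for the subdivided star is a real trigonometric polynomial in `t`
that takes the value `1` at `t = 0` and a nonpositive value at some later time, so by the
intermediate value theorem it vanishes at a positive time, and the infimum of its modulus is zero.

The adjacency matrix `A` has eigenvalues `0`, `±1` and `±√(m + 1)`. If `A² w = λ² w` with `λ ≠ 0`,
then `exp (i t A) w = cos (λ t) w + (i sin (λ t) / λ) A w` (`exp_mulVec_of_sq`). The graph is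
bipartite, so only the cosine term contributes to a diagonal entry when the indicator vector of a
vertex is split into eigenvectors of `A²`. With `s = √(m + 1)` this gives

* at the centre, `1 / (m + 1) + m / (m + 1) * cos (s t)`, nonpositive at `t = π / s`;
* at a middle vertex, `1 / m * cos (s t) + (1 - 1 / m) * cos t`;
* at a leaf, `1 / (m + 1) + cos (s t) / (m * (m + 1)) + (1 - 1 / m) * cos t`.

The last two are at most `(2 - m) / m ≤ 0` at `t = π`.
-/

namespace QuantumWalk

open Matrix

/-! ### Exponentials acting on eigenvectors -/

section Exponential

variable {V : Type*} [Fintype V] [DecidableEq V]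

open scoped Matrix.Norms.Operator in
theorem exp_mulVec_of_eigenvector {M : Matrix V V ℂ} {μ : ℂ} {v : V → ℂ} (h : M *ᵥ v = μ • v) :
    NormedSpace.exp M *ᵥ v = Complex.exp μ • v := by
  have hpow (n : ℕ) : M ^ n *ᵥ v = μ ^ n • v := by
    induction n with
    | zero => simp
    | succ n ih => rw [pow_succ, ← mulVec_mulVec, h, mulVec_smul, ih, smul_smul, pow_succ']
  have h₁ : HasSum (fun n : ℕ => ((n.factorial : ℂ)⁻¹ • M ^ n) *ᵥ v) (NormedSpace.exp M *ᵥ v) :=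
    (NormedSpace.exp_series_hasSum_exp' (𝕂 := ℂ) M).map
      (⟨⟨fun N : Matrix V V ℂ => N *ᵥ v, zero_mulVec v⟩, fun N N' => add_mulVec N N' v⟩ :
        Matrix V V ℂ →+ (V → ℂ)) (continuous_id.matrix_mulVec continuous_const)
  have h₂ : HasSum (fun n : ℕ => ((n.factorial : ℂ)⁻¹ • μ ^ n) • v) (NormedSpace.exp μ • v) :=
    (NormedSpace.exp_series_hasSum_exp' (𝕂 := ℂ) μ).smul_const v
  rw [Complex.exp_eq_exp_ℂ]
  refine h₁.unique ?_
  simpa only [smul_mulVec, hpow, smul_smul, smul_eq_mul] using h₂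

theorem exp_mulVec_of_sq {A : Matrix V V ℂ} {c : ℂ} {w : V → ℂ} (hc : c ≠ 0)
    (h : A *ᵥ (A *ᵥ w) = c ^ 2 • w) (t : ℂ) :
    NormedSpace.exp ((Complex.I * t) • A) *ᵥ w =
      Complex.cos (c * t) • w + (Complex.I * Complex.sin (c * t) / c) • (A *ᵥ w) := by
  -- `w` is the mean of the two eigenvectors `w ± c⁻¹ A w`, with eigenvalues `±c`.
  have key (d : ℂ) (hd : d ≠ 0) (hdc : d ^ 2 = c ^ 2) :
      NormedSpace.exp ((Complex.I * t) • A) *ᵥ (w + d⁻¹ • (A *ᵥ w)) =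
        (Complex.cos (d * t) + Complex.sin (d * t) * Complex.I) • (w + d⁻¹ • (A *ᵥ w)) := by
    rw [← Complex.exp_mul_I]
    refine exp_mulVec_of_eigenvector ?_
    rw [smul_mulVec, mulVec_add, mulVec_smul, h, ← hdc]
    ext v
    simp only [Pi.smul_apply, Pi.add_apply, smul_eq_mul]
    field_simp
    ring
  have hw : w = (2⁻¹ : ℂ) • (w + c⁻¹ • (A *ᵥ w)) + (2⁻¹ : ℂ) • (w + (-c)⁻¹ • (A *ᵥ w)) := by
    ext v
    simp only [Pi.smul_apply, Pi.add_apply, smul_eq_mul, inv_neg]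
    ring
  conv_lhs => rw [hw]
  rw [mulVec_add, mulVec_smul, mulVec_smul, key c hc rfl, key (-c) (neg_ne_zero.2 hc) (neg_sq c)]
  ext v
  simp only [Pi.smul_apply, Pi.add_apply, smul_eq_mul, neg_mul,
    Complex.cos_neg, Complex.sin_neg, inv_neg]
  field_simp
  ring

theorem exp_mulVec_of_mulVec_eq_zero {A : Matrix V V ℂ} {w : V → ℂ} (h : A *ᵥ w = 0) (c : ℂ) :
    NormedSpace.exp (c • A) *ᵥ w = w := by
  have := exp_mulVec_of_eigenvector (M := c • A) (μ := 0) (v := w)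
    (by rw [smul_mulVec, h, smul_zero, zero_smul])
  rwa [Complex.exp_zero, one_smul] at this

/-- By the intermediate value theorem, a vertex whose diagonal entry of `U(t)` is a continuous real
function, positive at `0` and nonpositive at a later time, is not sedentary. -/
theorem vertexNotSedentary_of_eq_ofReal {X : SimpleGraph V} [DecidableRel X.Adj] {u : V}
    {f : ℝ → ℝ} (hf : Continuous f) (h : ∀ t, transitionMatrix X t u u = f t) (h₀ : 0 < f 0)
    {T : ℝ} (hT : 0 < T) (hfT : f T ≤ 0) : VertexNotSedentary X u := by
  obtain ⟨t, ht, hft⟩ := intermediate_value_Icc' hT.le hf.continuousOn ⟨hfT, h₀.le⟩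
  have htpos : 0 < t := ht.1.lt_of_ne (by rintro rfl; exact h₀.ne' hft)
  refine le_antisymm ?_ (Real.iInf_nonneg fun _ => norm_nonneg _)
  refine (ciInf_le ⟨0, ?_⟩ (⟨t, htpos⟩ : Set.Ioi (0 : ℝ))).trans_eq ?_
  · rintro _ ⟨s, rfl⟩
    exact norm_nonneg _
  · simp [h, hft]

end Exponential

/-! ### The adjacency matrix of the subdivided star -/

section Star

variable {m : ℕ}

/-- The vector on the vertices of `G(m)` with value `a` at the centre, `f j` at the middle vertex
and `g j` at the leaf of branch `j`. -/
def starVec (a : ℂ) (f g : Fin m → ℂ) : StarVertex m → ℂ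
  | .center => a
  | .mid j => f j
  | .leaf j => g j

theorem adjMatrix_mulVec_starVec (a : ℂ) (f g : Fin m → ℂ) :
    (subdividedStar m).adjMatrix ℂ *ᵥ starVec a f g =
      starVec (∑ j, f j) (fun j => a + g j) f := by
  ext v
  rw [SimpleGraph.adjMatrix_mulVec_apply]
  rcases v with _ | j | j
  · have : (subdividedStar m).neighborFinset .center =
        Finset.univ.map ⟨StarVertex.mid, fun _ _ => StarVertex.mid.inj⟩ := by
      ext v
      rw [SimpleGraph.mem_neighborFinset]
      rcases v with _ | i | i
      · simp [subdividedStar]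
      · simpa [subdividedStar] using ⟨i, rfl⟩
      · simp [subdividedStar]
    rw [this, Finset.sum_map]
    rfl
  · have : (subdividedStar m).neighborFinset (.mid j) = {.center, .leaf j} := by
      ext v
      rw [SimpleGraph.mem_neighborFinset]
      rcases v with _ | i | i <;> simp [subdividedStar, eq_comm]
    rw [this, Finset.sum_pair (by simp)]
    rfl
  · have : (subdividedStar m).neighborFinset (.leaf j) = {.mid j} := by
      ext v
      rw [SimpleGraph.mem_neighborFinset]
      rcases v with _ | i | i <;> simp [subdividedStar, eq_comm]
    rw [this, Finset.sum_singleton]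
    rfl

theorem starVec_add (a b : ℂ) (f f' g g' : Fin m → ℂ) :
    starVec a f g + starVec b f' g' = starVec (a + b) (f + f') (g + g') := by
  ext (_ | j | j) <;> rfl

theorem smul_starVec (c a : ℂ) (f g : Fin m → ℂ) :
    c • starVec a f g = starVec (c * a) (c • f) (c • g) := by
  ext (_ | j | j) <;> rfl

/-- The positive square root of `m + 1`, the largest eigenvalue of the adjacency matrix. -/
noncomputable def starRadius (m : ℕ) : ℝ := √(m + 1)

theorem starRadius_pos (m : ℕ) : 0 < starRadius m := Real.sqrt_pos.2 (by positivity)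

theorem starRadius_sq (m : ℕ) : (starRadius m : ℂ) ^ 2 = m + 1 := by
  rw [← Complex.ofReal_pow, starRadius, Real.sq_sqrt (by positivity)]
  push_cast
  rfl

/-! ### Evolution of eigenvectors -/

theorem transitionMatrix_mulVec_of_sq {c : ℂ} (hc : c ≠ 0) {w : StarVertex m → ℂ}
    (h : (subdividedStar m).adjMatrix ℂ *ᵥ ((subdividedStar m).adjMatrix ℂ *ᵥ w) = c ^ 2 • w)
    {u : StarVertex m} (hu : ((subdividedStar m).adjMatrix ℂ *ᵥ w) u = 0) (t : ℝ) :
    (transitionMatrix (subdividedStar m) t *ᵥ w) u = Complex.cos (c * t) * w u := by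
  rw [transitionMatrix, exp_mulVec_of_sq hc h]
  simp [hu]

/-- The kernel of `A` consists of the vectors that vanish on the middle vertices and take a value `a`
at the centre and `-a` at every leaf; `U(t)` fixes them. -/
theorem transitionMatrix_mulVec_kernel (a : ℂ) (t : ℝ) :
    transitionMatrix (subdividedStar m) t *ᵥ starVec a 0 (fun _ => -a) =
      starVec a 0 fun _ => -a := by
  refine exp_mulVec_of_mulVec_eq_zero ?_ _
  rw [adjMatrix_mulVec_starVec]
  ext (_ | j | j) <;> simp [starVec]

/-- The eigenvectors of `A²` for `m + 1` supported on the centre and the leaves. The vertex `u` must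
not be a middle vertex, because `A` maps them to vectors supported on the middle vertices. -/
theorem transitionMatrix_mulVec_radial_even (a : ℂ) {u : StarVertex m}
    (hu : ∀ j, u ≠ .mid j) (t : ℝ) :
    (transitionMatrix (subdividedStar m) t *ᵥ starVec (m * a) 0 (fun _ => a)) u =
      Complex.cos (starRadius m * t) * starVec (m * a) 0 (fun _ => a) u := by
  refine transitionMatrix_mulVec_of_sq
    (Complex.ofReal_ne_zero.2 (starRadius_pos m).ne') ?_ ?_ t
  · rw [starRadius_sq, adjMatrix_mulVec_starVec, adjMatrix_mulVec_starVec, smul_starVec]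
    ext (_ | j | j) <;> simp [starVec] <;> ring
  · rw [adjMatrix_mulVec_starVec]
    rcases u with _ | j | j
    · simp [starVec]
    · exact absurd rfl (hu j)
    · simp [starVec]

/-- The eigenvectors of `A²` for `m + 1` that are constant on the middle vertices. -/
theorem transitionMatrix_mulVec_radial_odd (a : ℂ) (t : ℝ) (j : Fin m) :
    (transitionMatrix (subdividedStar m) t *ᵥ starVec 0 (fun _ => a) 0) (.mid j) =
      Complex.cos (starRadius m * t) * a := by
  refine transitionMatrix_mulVec_of_sq (w := starVec 0 (fun _ => a) 0)
    (Complex.ofReal_ne_zero.2 (starRadius_pos m).ne') ?_ ?_ t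
  · rw [starRadius_sq, adjMatrix_mulVec_starVec, adjMatrix_mulVec_starVec, smul_starVec]
    ext (_ | j | j)
    · simp [starVec]
    · simp [starVec]
      ring
    · simp [starVec]
  · rw [adjMatrix_mulVec_starVec]
    simp [starVec]

/-- The eigenvectors of `A²` for `1` supported on the middle vertices, with entries summing to
zero. -/
theorem transitionMatrix_mulVec_mid {f : Fin m → ℂ} (hf : ∑ j, f j = 0) (t : ℝ) (j : Fin m) :
    (transitionMatrix (subdividedStar m) t *ᵥ starVec 0 f 0) (.mid j) = Complex.cos t * f j := by
  have := transitionMatrix_mulVec_of_sq (w := starVec 0 f 0) (u := .mid j) one_ne_zero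
    (by
      rw [adjMatrix_mulVec_starVec, adjMatrix_mulVec_starVec]
      ext (_ | j | j) <;> simp [starVec, hf])
    (by
      rw [adjMatrix_mulVec_starVec]
      simp [starVec]) t
  rwa [one_mul] at this

/-- The eigenvectors of `A²` for `1` supported on the leaves, with entries summing to zero. -/
theorem transitionMatrix_mulVec_leaf {g : Fin m → ℂ} (hg : ∑ j, g j = 0) (t : ℝ) (j : Fin m) :
    (transitionMatrix (subdividedStar m) t *ᵥ starVec 0 0 g) (.leaf j) = Complex.cos t * g j := by
  have := transitionMatrix_mulVec_of_sq (w := starVec 0 0 g) (u := .leaf j) one_ne_zero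
    (by
      rw [adjMatrix_mulVec_starVec, adjMatrix_mulVec_starVec]
      ext (_ | j | j) <;> simp [starVec, hg])
    (by
      rw [adjMatrix_mulVec_starVec]
      simp [starVec]) t
  rwa [one_mul] at this

/-! ### Diagonal entries of the transition matrix -/

theorem transitionMatrix_center (t : ℝ) :
    transitionMatrix (subdividedStar m) t .center .center =
      ((1 / (m + 1) + m / (m + 1) * Real.cos (starRadius m * t) : ℝ) : ℂ) := by
  have hm : (m + 1 : ℂ) ≠ 0 := Nat.cast_add_one_ne_zero m
  -- Components of the indicator vector for the eigenvalues `0` and `m + 1` of `A²`.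
  have hsplit : Pi.single StarVertex.center (1 : ℂ) =
      starVec (1 / (m + 1)) 0 (fun _ : Fin m => -(1 / (m + 1))) +
        starVec (m * (1 / (m + 1))) 0 fun _ => 1 / (m + 1) := by
    rw [starVec_add]
    ext (_ | j | j)
    · simp [starVec]
      field_simp
      ring
    · simp [starVec]
    · simp [starVec]
  have hcol := congrFun (mulVec_single_one (transitionMatrix (subdividedStar m) t) .center) .center
  rw [col_apply] at hcol
  rw [← hcol, hsplit, mulVec_add, Pi.add_apply, transitionMatrix_mulVec_kernel,
    transitionMatrix_mulVec_radial_even _ (by simp)]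
  simp only [starVec]
  push_cast
  ring

theorem sum_single_sub_const (hm : m ≠ 0) (j : Fin m) :
    ∑ i, (Pi.single j 1 - fun _ => 1 / (m : ℂ) : Fin m → ℂ) i = 0 := by
  simp [Finset.sum_sub_distrib, hm]

theorem transitionMatrix_mid (hm : m ≠ 0) (t : ℝ) (j : Fin m) :
    transitionMatrix (subdividedStar m) t (.mid j) (.mid j) =
      ((1 / m * Real.cos (starRadius m * t) + (1 - 1 / m) * Real.cos t : ℝ) : ℂ) := by
  -- Components of the indicator vector for the eigenvalues `m + 1` and `1` of `A²`.
  have hsplit : Pi.single (StarVertex.mid j) (1 : ℂ) =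
      starVec 0 (fun _ => 1 / (m : ℂ)) 0 +
        starVec 0 (Pi.single j (1 : ℂ) - fun _ => 1 / (m : ℂ)) 0 := by
    rw [starVec_add]
    ext (_ | i | i)
    · simp [starVec]
    · simp [starVec, Pi.single_apply]
    · simp [starVec]
  have hcol := congrFun
    (mulVec_single_one (transitionMatrix (subdividedStar m) t) (.mid j)) (.mid j)
  rw [col_apply] at hcol
  rw [← hcol, hsplit, mulVec_add, Pi.add_apply, transitionMatrix_mulVec_radial_odd,
    transitionMatrix_mulVec_mid (sum_single_sub_const hm j)]
  simp only [Pi.sub_apply, Pi.single_eq_same]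
  push_cast
  ring

theorem transitionMatrix_leaf (hm : m ≠ 0) (t : ℝ) (j : Fin m) :
    transitionMatrix (subdividedStar m) t (.leaf j) (.leaf j) =
      ((1 / (m + 1) + 1 / (m * (m + 1)) * Real.cos (starRadius m * t) +
        (1 - 1 / m) * Real.cos t : ℝ) : ℂ) := by
  have hm₀ : (m : ℂ) ≠ 0 := Nat.cast_ne_zero.2 hm
  have hm₁ : (m + 1 : ℂ) ≠ 0 := Nat.cast_add_one_ne_zero m
  -- Components of the indicator vector for the eigenvalues `0`, `m + 1` and `1` of `A²`; `- -` keeps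
  -- the first in the form required by `transitionMatrix_mulVec_kernel`.
  have hsplit : Pi.single (StarVertex.leaf j) (1 : ℂ) =
      starVec (-(1 / (m + 1))) 0 (fun _ : Fin m => - -(1 / (m + 1))) +
        starVec (m * (1 / (m * (m + 1)))) 0 (fun _ => 1 / (m * (m + 1))) +
          starVec 0 0 (Pi.single j (1 : ℂ) - fun _ => 1 / (m : ℂ)) := by
    rw [starVec_add, starVec_add]
    ext (_ | i | i)
    · simp [starVec]
      field_simp
      ring
    · simp [starVec]
    · simp [starVec, Pi.single_apply]
      field_simp
      ring
  have hcol := congrFun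
    (mulVec_single_one (transitionMatrix (subdividedStar m) t) (.leaf j)) (.leaf j)
  rw [col_apply] at hcol
  rw [← hcol, hsplit, mulVec_add, mulVec_add, Pi.add_apply, Pi.add_apply,
    transitionMatrix_mulVec_kernel, transitionMatrix_mulVec_radial_even _ (by simp),
    transitionMatrix_mulVec_leaf (sum_single_sub_const hm j)]
  simp only [starVec, Pi.sub_apply, Pi.single_eq_same]
  push_cast
  ring

/-! ### Nonpositive values of the diagonal entries -/

theorem vertexNotSedentary_center (hm : 1 ≤ m) :
    VertexNotSedentary (subdividedStar m) .center := by
  have hm' : (1 : ℝ) ≤ m := by exact_mod_cast hm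
  refine vertexNotSedentary_of_eq_ofReal (by fun_prop) transitionMatrix_center ?_
    (div_pos Real.pi_pos (starRadius_pos m)) ?_
  · rw [mul_zero, Real.cos_zero]
    positivity
  · rw [mul_div_cancel₀ _ (starRadius_pos m).ne', Real.cos_pi]
    have : (1 / (m + 1) + m / (m + 1) * (-1) : ℝ) = (1 - m) / (m + 1) := by ring
    rw [this]
    exact div_nonpos_of_nonpos_of_nonneg (by linarith) (by linarith)

theorem vertexNotSedentary_mid (hm : 2 ≤ m) (j : Fin m) :
    VertexNotSedentary (subdividedStar m) (.mid j) := by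
  have hm' : (2 : ℝ) ≤ m := by exact_mod_cast hm
  have hinv : (1 / m : ℝ) ≤ 1 / 2 := one_div_le_one_div_of_le two_pos hm'
  have hpos : (0 : ℝ) < 1 / m := by positivity
  refine vertexNotSedentary_of_eq_ofReal (by fun_prop)
    (fun t => transitionMatrix_mid (by omega) t j) ?_ Real.pi_pos ?_
  · rw [mul_zero, Real.cos_zero]
    linarith
  · rw [Real.cos_pi]
    have := mul_le_mul_of_nonneg_left (Real.cos_le_one (starRadius m * Real.pi)) hpos.le
    linarith

theorem vertexNotSedentary_leaf (hm : 2 ≤ m) (j : Fin m) :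
    VertexNotSedentary (subdividedStar m) (.leaf j) := by
  have hm' : (2 : ℝ) ≤ m := by exact_mod_cast hm
  have hinv : (1 / m : ℝ) ≤ 1 / 2 := one_div_le_one_div_of_le two_pos hm'
  have hpos : (0 : ℝ) < 1 / (m * (m + 1)) := by positivity
  have hsum : (1 / (m + 1) + 1 / (m * (m + 1)) : ℝ) = 1 / m := by
    field_simp
  refine vertexNotSedentary_of_eq_ofReal (by fun_prop)
    (fun t => transitionMatrix_leaf (by omega) t j) ?_ Real.pi_pos ?_
  · rw [mul_zero, Real.cos_zero]
    linarith
  · rw [Real.cos_pi]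
    have := mul_le_mul_of_nonneg_left (Real.cos_le_one (starRadius m * Real.pi)) hpos.le
    linarith

end Star

end QuantumWalk

theorem mainTheorem12 (m : ℕ) (hm : 2 ≤ m) :
    QuantumWalk.NotSedentary (QuantumWalk.subdividedStar m) := by
  rintro (_ | j | j)
  · exact QuantumWalk.vertexNotSedentary_center (by omega)
  · exact QuantumWalk.vertexNotSedentary_mid hm j
  · exact QuantumWalk.vertexNotSedentary_leaf hm j
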